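/- For labels $\mathbf y\in\{-1,1\}^N$ and a data matrix $\mathbf X\in\mathbb R^{N\times K}$ with rows $\mathbf x_i^T$, let $\mathcal L(\beta;\mathbf X)=\sum_{i=1}^N\log(1+e^{-\mathbf y_i\mathbf x_i^T\beta})$ be the logistic loss and $$\mu_{\mathbf y}(\mathbf X)=\sup_{\beta\ne 0}\frac{\|(\mathbf D_{\mathbf y}\mathbf X\beta)^+\|_1}{\|(\mathbf D_{\mathbf y}\mathbf X\beta)^-\|_1},\qquad \mathbf D_{\mathbf y}=\operatorname{diag}(\mathbf y),$$ where $v^+$ and $v^-$ are the positive and negative parts of $v$ (and $\beta$ with $\mathbf D_{\mathbf y}\mathbf X\beta=0$ are ignored). Take $\mathbf y=(-1,\dots,-1)$ throughout. A randomized data structure stores for each input matrix $\mathbf X$ a bit string (possibly depending on a random seed) and answers a query $\beta$ by a number $\tilde{\mathcal L}(\beta;\mathbf X)$ computed from the stored bit string and the seed only; the seed is not counted as space, and running times are unrestricted. There are constants $\varepsilon_0,c,C>0$ and $n_0\ge 2$ such that for all integers $n\ge n_0$ and $d\ge 1$ there are an integer $1\le k\le C\log^4 n$ and a set $\mathcal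 X$ of matrices in $\mathbb R^{dn\times dk}$ with the following properties. 1. Every $\mathbf X\in\mathcal X$ has rational entries that can each be specified in at most $C\log(dn)$ bits, and $c\,n/\log^2 n\le\mu_{\mathbf y}(\mathbf X)\le C\,n$. 2. Let a randomized data structure satisfy, for every $\mathbf X\in\mathcal X$ and every fixed $\beta\in\mathbb R^{dk}$, $$(1-\varepsilon_0)\,\mathcal L(\beta;\mathbf X)\le\tilde{\mathcal L}(\beta;\mathbf X)\le(1+\varepsilon_0)\,\mathcal L(\beta;\mathbf X)\quad\text{with probability at least }2/3.$$ Then there is an $\mathbf X\in\mathcal X$ for which it stores, for some value of the seed, at least $$c\cdot\frac{dk\cdot\mu_{\mathbf y}(\mathbf X)}{\log^4 n}=\tilde\Omega\big(dk\cdot\mu_{\mathbf y}(\mathbf X)\big)$$ bits; here $dk$ is the number of columns of $\mathbf X$. -/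

import Mathlib

open MeasureTheory
open scoped Matrix ENNReal

universe u

/-- The logistic loss of the data matrix `X` (whose rows are the data points) with labels `y`,
`L(β) = ∑ i, log (1 + exp (- y i * ⟨X i, β⟩))`. -/
noncomputable def logisticLoss {ι κ : Type*} [Fintype ι] [Fintype κ]
    (X : Matrix ι κ ℝ) (y : ι → ℝ) (β : κ → ℝ) : ℝ :=
  ∑ i, Real.log (1 + Real.exp (-(y i * (X *ᵥ β) i)))

/-- The classification complexity measure: the supremum over `β ≠ 0` of
`‖(D_y X β)⁺‖₁ / ‖(D_y X β)⁻‖₁`, as an extended nonnegative real.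
A positive number divided by `0` is `∞` here; the quotient `0 / 0`, which occurs exactly for
`D_y X β = 0`, is `0` and so does not contribute to the supremum. -/
noncomputable def complexityMeasure {ι κ : Type*} [Fintype ι] [Fintype κ]
    (X : Matrix ι κ ℝ) (y : ι → ℝ) : ℝ≥0∞ :=
  ⨆ (β : κ → ℝ) (_ : β ≠ 0),
    ENNReal.ofReal (∑ i, max (y i * (X *ᵥ β) i) 0) /
      ENNReal.ofReal (∑ i, max (-(y i * (X *ᵥ β) i)) 0)

/-- Number of bits of the standard binary encoding of a rational number: sign, numerator and
denominator. -/
def ratBits (q : ℚ) : ℕ := 1 + Nat.size q.num.natAbs + Nat.size q.den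

/-- Every entry of `X` is a rational number that can be specified in at most `b` bits. -/
def EntriesInBits {ι κ : Type*} (X : Matrix ι κ ℝ) (b : ℝ) : Prop :=
  ∀ i j, ∃ q : ℚ, X i j = (q : ℝ) ∧ (ratBits q : ℝ) ≤ b

/-- A randomized data structure that compresses a data matrix to a bit string and answers queries
`β` with a real number, computed from the stored bit string alone. The random seed `ω` is shared
by the compression and the queries, and it is not counted as space; there is no
restriction on running times. -/
structure DataStructure (ι κ : Type) where
  /-- the space of random seeds -/
  Ω : Type u
  [mΩ : MeasurableSpace Ω]
  /-- the law of the random seed -/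
  P : Measure Ω
  [prob : IsProbabilityMeasure P]
  /-- the bit string stored for the data matrix `X` when the seed is `ω` -/
  store : Ω → Matrix ι κ ℝ → List Bool
  /-- the answer to the query `β` when the seed is `ω` and the stored bit string is `m` -/
  query : Ω → List Bool → (κ → ℝ) → ℝ
  measurableSet_store : ∀ X m, MeasurableSet {ω | store ω X = m}
  measurable_query : ∀ m β, Measurable fun ω => query ω m β

attribute [instance] DataStructure.mΩ DataStructure.prob

/-- On the input `X` with labels `y`, the data structure approximates the logistic loss up to
relative error `ε` in the for-each sense: for every fixed `β`, its answer is accurate with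
probability at least `2 / 3`. -/
def DataStructure.ApproximatesLoss {ι κ : Type} [Fintype ι] [Fintype κ]
    (D : DataStructure.{u} ι κ) (X : Matrix ι κ ℝ) (y : ι → ℝ) (ε : ℝ) : Prop :=
  ∀ β : κ → ℝ,
    2 / 3 ≤ D.P.real {ω | (1 - ε) * logisticLoss X y β ≤ D.query ω (D.store ω X) β ∧
      D.query ω (D.store ω X) β ≤ (1 + ε) * logisticLoss X y β}

/-! The matrices in `𝒳` encode bit strings that any accurate data structure must remember. With `L ≈
log₂ n`, a block holds `N ≈ n / (4 * L)` points `W * (s j • u j, 1)`, where the `u j` are distinct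
sign vectors of length `L` and `W = 4 * L`; the `d` blocks thus carry `d * N` free bits. The query
`M * (u j, -(L - 1))` makes row `j` positive exactly when its bit is on, and no other point row,
because distinct sign vectors have inner product below `L`. The rows `± e_c` contribute `M * (2 * L
- 1)`, so a switched-on bit roughly triples the loss, and a `1/4`-approximation reveals it
(`sum_posPart_separatingQuery`). These same rows `± e_c` bound the positive part of `X β` below by
`‖β‖₁`, which keeps the complexity measure between `W * N` and `W * N + 1`, of order `n`. A random
access code bound (`exists_length_ge_of_agreement`) then forces about `d * N / 15` stored bits,
which exceeds the claimed bound once logarithms are counted. -/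

/-! ### Counting bit strings and random access codes -/

/-- The natural number whose binary digits are those of `l`, with a leading digit `1`. -/
def natOfBits : List Bool → ℕ
  | [] => 1
  | b :: l => Nat.bit b (natOfBits l)

theorem natOfBits_pos : ∀ l, 0 < natOfBits l
  | [] => one_pos
  | b :: l => by
    have := natOfBits_pos l
    rw [natOfBits, Nat.bit_val]
    omega

/-- The leading digit `1` marks the length, so lists differing only by trailing `false`s stay
distinct. -/
theorem natOfBits_injective : Function.Injective natOfBits := by
  intro l
  induction l with
  | nil =>
    rintro (_ | ⟨b, l'⟩) h
    · rfl
    · have := natOfBits_pos l'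
      simp only [natOfBits, Nat.bit_val] at h
      omega
  | cons b l ih =>
    rintro (_ | ⟨b', l'⟩) h
    · have := natOfBits_pos l
      simp only [natOfBits, Nat.bit_val] at h
      omega
    · simp only [natOfBits] at h
      have h2 : natOfBits l = natOfBits l' := by
        rw [← Nat.bit_div_two b (natOfBits l), h, Nat.bit_div_two]
      have h1 : b = b' := by
        rw [← Nat.testBit_bit_zero b (natOfBits l), h, Nat.testBit_bit_zero]
      rw [h1, ih h2]

theorem natOfBits_lt (l : List Bool) : natOfBits l < 2 ^ (l.length + 1) := by
  induction l with
  | nil => simp [natOfBits]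
  | cons b l ih =>
    have hb : b.toNat ≤ 1 := Bool.toNat_le b
    rw [natOfBits, Nat.bit_val, List.length_cons, pow_succ 2 (l.length + 1)]
    omega

theorem card_le_two_pow_of_length_le (S : Finset (List Bool)) (b : ℕ)
    (h : ∀ l ∈ S, l.length ≤ b) : S.card ≤ 2 ^ (b + 1) := by
  rw [← Finset.card_range (2 ^ (b + 1))]
  refine Finset.card_le_card_of_injOn natOfBits (fun l hl => ?_) natOfBits_injective.injOn
  exact Finset.mem_coe.2 (Finset.mem_range.2 ((natOfBits_lt l).trans_le
    (Nat.pow_le_pow_right two_pos (Nat.succ_le_succ (h l hl)))))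

/-- The exponential moment of the number of bits guessed correctly by a fixed string: it factors
over the bits, each giving `2 + 1`. -/
theorem sum_prod_agreement {T : Type*} [Fintype T] [DecidableEq T] (z : T → Bool) :
    ∑ x : T → Bool, ∏ i, (if z i = x i then (2 : ℝ) else 1) = 3 ^ Fintype.card T := by
  rw [← Fintype.prod_sum (fun i b => if z i = b then (2 : ℝ) else 1)]
  have h : ∀ i, ∑ b : Bool, (if z i = b then (2 : ℝ) else 1) = 3 := by
    intro i
    cases z i <;> norm_num
  rw [Finset.prod_congr rfl fun i _ => h i]
  simp

/-- A bound for random access codes: if messages `E x` allow to recover two thirds of the bits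
of `x` on average, then some message is long. -/
theorem exists_length_ge_of_agreement {T : Type*} [Fintype T] [DecidableEq T]
    (E : (T → Bool) → List Bool) (z : List Bool → T → Bool)
    (h : 2 / 3 * (Fintype.card T : ℝ) * 2 ^ Fintype.card T ≤
      ∑ x : T → Bool, ∑ i, if z (E x) i = x i then (1 : ℝ) else 0) :
    ∃ x, (Fintype.card T : ℝ) / 15 - 1 ≤ (E x).length := by
  obtain ⟨x₀, -, hx₀⟩ := Finset.exists_max_image (Finset.univ : Finset (T → Bool))
    (fun x => (E x).length) Finset.univ_nonempty
  refine ⟨x₀, ?_⟩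
  set t : ℝ := ((Fintype.card T : ℕ) : ℝ) with ht
  have hcard := card_le_two_pow_of_length_le (Finset.univ.image E) (E x₀).length (by
    intro l hl
    obtain ⟨x, -, rfl⟩ := Finset.mem_image.1 hl
    exact hx₀ x (Finset.mem_univ x))
  have hlog2 : 0 < Real.log 2 := Real.log_pos one_lt_two
  have hprod : ∀ x : T → Bool, ∏ i, (if z (E x) i = x i then (2 : ℝ) else 1) =
      Real.exp (Real.log 2 * ∑ i, if z (E x) i = x i then (1 : ℝ) else 0) := by
    intro x
    rw [Finset.mul_sum, Real.exp_sum]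
    refine Finset.prod_congr rfl fun i _ => ?_
    split_ifs
    · rw [mul_one, Real.exp_log two_pos]
    · simp
  -- Jensen's inequality for `2 ^ agreement`, through the tangent line at the value `2 / 3 * t`.
  have hlower : Real.exp (Real.log 2 * (2 / 3 * t)) * 2 ^ Fintype.card T ≤
      ∑ x : T → Bool, ∏ i, (if z (E x) i = x i then (2 : ℝ) else 1) := by
    have htan : ∀ x : T → Bool,
        Real.exp (Real.log 2 * (2 / 3 * t)) * (1 + Real.log 2 *
          ((∑ i, if z (E x) i = x i then (1 : ℝ) else 0) - 2 / 3 * t)) ≤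
        ∏ i, (if z (E x) i = x i then (2 : ℝ) else 1) := by
      intro x
      rw [hprod]
      have := Real.add_one_le_exp (Real.log 2 *
          ((∑ i, if z (E x) i = x i then (1 : ℝ) else 0) - 2 / 3 * t))
      calc _ ≤ Real.exp (Real.log 2 * (2 / 3 * t)) * Real.exp (Real.log 2 *
          ((∑ i, if z (E x) i = x i then (1 : ℝ) else 0) - 2 / 3 * t)) := by
            gcongr; linarith
        _ = _ := by rw [← Real.exp_add]; ring_nf
    refine le_trans ?_ (Finset.sum_le_sum fun x _ => htan x)
    rw [← Finset.mul_sum]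
    gcongr
    rw [Finset.sum_add_distrib, ← Finset.mul_sum, Finset.sum_sub_distrib]
    simp only [Finset.sum_const, Finset.card_univ, Fintype.card_fun, Fintype.card_bool,
      nsmul_eq_mul, mul_one]
    push_cast
    have : 0 ≤ Real.log 2 * ((∑ x : T → Bool, ∑ i, if z (E x) i = x i then (1 : ℝ) else 0) -
        2 ^ Fintype.card T * (2 / 3 * t)) := by
      apply mul_nonneg hlog2.le
      linarith
    linarith
  -- Union bound over messages: each decoded string has total moment `3 ^ t`.
  have hupper : ∑ x : T → Bool, ∏ i, (if z (E x) i = x i then (2 : ℝ) else 1) ≤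
      2 ^ ((E x₀).length + 1) * 3 ^ Fintype.card T := by
    calc _ ≤ ∑ x : T → Bool, ∑ m ∈ Finset.univ.image E,
          ∏ i, (if z m i = x i then (2 : ℝ) else 1) := by
          refine Finset.sum_le_sum fun x _ => ?_
          exact Finset.single_le_sum
            (f := fun m => ∏ i, (if z m i = x i then (2 : ℝ) else 1))
            (fun m _ => Finset.prod_nonneg fun i _ => by split_ifs <;> norm_num)
            (Finset.mem_image_of_mem E (Finset.mem_univ x))
      _ = (Finset.univ.image E).card * 3 ^ Fintype.card T := by
          rw [Finset.sum_comm, Finset.sum_congr rfl fun m _ => sum_prod_agreement (z m)]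
          simp
      _ ≤ _ := by
          gcongr
          exact_mod_cast hcard
  have hfin := Real.log_le_log (by positivity) (hlower.trans hupper)
  rw [Real.log_mul (by positivity) (by positivity), Real.log_mul (by positivity) (by positivity),
    Real.log_exp, Real.log_pow, Real.log_pow, Real.log_pow, ← ht] at hfin
  -- With `log₂ 3 ≤ 8 / 5`, the rate is at least `1 + 2 / 3 - 8 / 5 = 1 / 15`.
  have hlog3 : 5 * Real.log 3 ≤ 8 * Real.log 2 := by
    have := Real.log_le_log (by norm_num) (by norm_num : (3 : ℝ) ^ 5 ≤ 2 ^ 8)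
    rw [Real.log_pow, Real.log_pow] at this
    exact_mod_cast this
  have ht0 : 0 ≤ t := Nat.cast_nonneg _
  have h3 : t * Real.log 3 ≤ t * (8 / 5 * Real.log 2) := by gcongr; linarith
  push_cast at hfin
  refine le_of_mul_le_mul_right ?_ hlog2
  linarith

/-! ### From data structures to codes -/

theorem DataStructure.measurableSet_query_store {ι κ : Type} (D : DataStructure.{u} ι κ)
    (X : Matrix ι κ ℝ) (β : κ → ℝ) {s : Set ℝ} (hs : MeasurableSet s) :
    MeasurableSet {ω | D.query ω (D.store ω X) β ∈ s} := by
  have : {ω | D.query ω (D.store ω X) β ∈ s} =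
      ⋃ m : List Bool, {ω | D.store ω X = m} ∩ {ω | D.query ω m β ∈ s} := by
    ext ω
    simp
  rw [this]
  exact MeasurableSet.iUnion fun m =>
    (D.measurableSet_store X m).inter (D.measurable_query m β hs)

/-- If each of the bits `x i` of an input `X x` can be read off from any approximate answer to
the query `β i`, then a data structure has to store a constant fraction of the number of bits. -/
theorem DataStructure.exists_length_ge {ι κ : Type} [Fintype ι] [Fintype κ]
    {T : Type} [Fintype T] [DecidableEq T] (D : DataStructure.{u} ι κ)
    (X : (T → Bool) → Matrix ι κ ℝ) (y : ι → ℝ) (ε θ : ℝ) (β : T → κ → ℝ)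
    (hD : ∀ x, D.ApproximatesLoss (X x) y ε)
    (htrue : ∀ x i, x i = true → θ < (1 - ε) * logisticLoss (X x) y (β i))
    (hfalse : ∀ x i, x i = false → (1 + ε) * logisticLoss (X x) y (β i) ≤ θ) :
    ∃ x ω, (Fintype.card T : ℝ) / 15 - 1 ≤ (D.store ω (X x)).length := by
  classical
  let A : (T → Bool) → T → Set D.Ω := fun x i =>
    {ω | D.query ω (D.store ω (X x)) (β i) ∈ Set.Icc ((1 - ε) * logisticLoss (X x) y (β i))
      ((1 + ε) * logisticLoss (X x) y (β i))}
  have hA : ∀ x i, MeasurableSet (A x i) := fun x i =>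
    D.measurableSet_query_store (X x) (β i) measurableSet_Icc
  have hPA : ∀ x i, 2 / 3 ≤ D.P.real (A x i) := fun x i => hD x (β i)
  let f : D.Ω → ℝ := fun ω => ∑ x, ∑ i, (A x i).indicator 1 ω
  have hi : ∀ x i, Integrable ((A x i).indicator (1 : D.Ω → ℝ)) D.P := fun x i =>
    (integrable_const (1 : ℝ)).indicator (hA x i)
  have hf : Integrable f D.P :=
    integrable_finsetSum _ fun x _ => integrable_finsetSum _ fun i _ => hi x i
  have hint : 2 / 3 * (Fintype.card T : ℝ) * 2 ^ Fintype.card T ≤ ∫ ω, f ω ∂D.P := by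
    have : ∫ ω, f ω ∂D.P = ∑ x, ∑ i, D.P.real (A x i) := by
      rw [integral_finsetSum _ fun x _ => integrable_finsetSum _ fun i _ => hi x i]
      refine Finset.sum_congr rfl fun x _ => ?_
      rw [integral_finsetSum _ fun i _ => hi x i]
      exact Finset.sum_congr rfl fun i _ => integral_indicator_one (hA x i)
    rw [this]
    refine le_trans (le_of_eq ?_)
      (Finset.sum_le_sum fun x _ => Finset.sum_le_sum fun i _ => hPA x i)
    simp
    ring
  -- Some seed does at least as well as the average; fixing it leaves a deterministic code.
  obtain ⟨ω, hω⟩ := exists_integral_le hf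
  obtain ⟨x, hx⟩ := exists_length_ge_of_agreement (fun x => D.store ω (X x))
    (fun m i => decide (θ < D.query ω m (β i))) (by
      refine (hint.trans hω).trans (Finset.sum_le_sum fun x _ => Finset.sum_le_sum fun i _ => ?_)
      by_cases h : ω ∈ A x i
      · rw [Set.indicator_of_mem h, if_pos]
        · rfl
        · obtain ⟨h1, h2⟩ := h
          cases hxi : x i
          · simpa using h2.trans (hfalse x i hxi)
          · simpa using (htrue x i hxi).trans_le h1
      · rw [Set.indicator_of_notMem h]
        split_ifs <;> norm_num)
  exact ⟨x, ω, hx⟩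

/-! ### Logistic loss versus positive part -/

theorem max_zero_le_log_one_add_exp (t : ℝ) : max t 0 ≤ Real.log (1 + Real.exp t) := by
  have h := Real.exp_pos t
  refine max_le ?_ (Real.log_nonneg (by linarith))
  rw [Real.le_log_iff_exp_le (by linarith)]
  linarith

theorem log_one_add_exp_le (t : ℝ) : Real.log (1 + Real.exp t) ≤ max t 0 + 1 := by
  rw [Real.log_le_iff_le_exp (by positivity), Real.exp_add]
  have h1 : Real.exp t ≤ Real.exp (max t 0) := Real.exp_le_exp.2 (le_max_left _ _)
  have h2 : 1 ≤ Real.exp (max t 0) := Real.one_le_exp (le_max_right _ _)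
  have h3 : (2 : ℝ) ≤ Real.exp 1 := by linarith [Real.add_one_le_exp (1 : ℝ)]
  nlinarith

theorem sum_posPart_le_logisticLoss {ι κ : Type*} [Fintype ι] [Fintype κ]
    (X : Matrix ι κ ℝ) (β : κ → ℝ) :
    ∑ i, max ((X *ᵥ β) i) 0 ≤ logisticLoss X (fun _ => -1) β := by
  refine Finset.sum_le_sum fun i _ => ?_
  simpa using max_zero_le_log_one_add_exp ((X *ᵥ β) i)

theorem logisticLoss_le_sum_posPart_add_card {ι κ : Type*} [Fintype ι] [Fintype κ]
    (X : Matrix ι κ ℝ) (β : κ → ℝ) :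
    logisticLoss X (fun _ => -1) β ≤ ∑ i, max ((X *ᵥ β) i) 0 + Fintype.card ι := by
  calc logisticLoss X (fun _ => -1) β ≤ ∑ i, (max ((X *ᵥ β) i) 0 + 1) := by
        refine Finset.sum_le_sum fun i _ => ?_
        simpa using log_one_add_exp_le ((X *ᵥ β) i)
    _ = _ := by simp [Finset.sum_add_distrib]

/-! ### The hard matrices and their complexity -/

/-- The sign `±1` of a bit. -/
def signOf (b : Bool) : ℤ := if b then 1 else -1

theorem signOf_mul_self (b : Bool) : signOf b * signOf b = 1 := by cases b <;> rfl

theorem abs_signOf (b : Bool) : |signOf b| = 1 := by cases b <;> rfl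

theorem sum_signOf_mul_le {L : ℕ} {x y : Fin L → Bool} (h : x ≠ y) :
    ∑ l, signOf (x l) * signOf (y l) ≤ (L : ℤ) - 1 := by
  obtain ⟨l₀, hl₀⟩ := Function.ne_iff.1 h
  have h1 : ∑ l, signOf (x l) * signOf (y l) < ∑ _l : Fin L, (1 : ℤ) := by
    refine Finset.sum_lt_sum (fun l _ => ?_) ⟨l₀, Finset.mem_univ _, ?_⟩
    · cases x l <;> cases y l <;> decide
    · revert hl₀
      cases x l₀ <;> cases y l₀ <;> decide
  simp at h1
  omega

/-- The rows of one diagonal block: scaled points `W (s j • u j, 1)`, where `u j` is a sign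
vector and the bit `s j` tells whether it is switched on, the vectors `± e_c` of the standard
basis, and zero rows. -/
def blockRow {N L R : ℕ} (u : Fin N → Fin L → Bool) (W : ℤ) (s : Fin N → Bool) :
    Fin N ⊕ ((Option (Fin L) ⊕ Option (Fin L)) ⊕ Fin R) → Option (Fin L) → ℤ
  | .inl _, none => W
  | .inl j, some l => if s j then W * signOf (u j l) else 0
  | .inr (.inl (.inl c')), c => if c' = c then 1 else 0
  | .inr (.inl (.inr c')), c => if c' = c then -1 else 0
  | .inr (.inr _), _ => 0

theorem abs_blockRow_le {N L R : ℕ} (u : Fin N → Fin L → Bool) {W : ℤ} (hW : 1 ≤ W)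
    (s : Fin N → Bool) (i : Fin N ⊕ ((Option (Fin L) ⊕ Option (Fin L)) ⊕ Fin R))
    (c : Option (Fin L)) : |blockRow u W s i c| ≤ W := by
  have h0 : |W| = W := abs_of_nonneg (by omega)
  rcases i with j | (c' | c') | r
  · rcases c with _ | l
    · exact h0.le
    · rw [blockRow]
      split_ifs
      · rw [abs_mul, abs_signOf, h0, mul_one]
      · simp; omega
  · rw [blockRow]; split_ifs <;> simp <;> omega
  · rw [blockRow]; split_ifs <;> simp <;> omega
  · rw [blockRow]; simp; omega

/-- The block diagonal matrix with blocks `blockRow`, whose rows and columns are enumerated by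
the equivalences `e` and `f`. -/
def hardMatrix {d N L R m q : ℕ}
    (e : Fin d × (Fin N ⊕ ((Option (Fin L) ⊕ Option (Fin L)) ⊕ Fin R)) ≃ Fin m)
    (f : Fin d × Option (Fin L) ≃ Fin q) (u : Fin N → Fin L → Bool) (W : ℕ)
    (s : Fin d × Fin N → Bool) : Matrix (Fin m) (Fin q) ℝ :=
  fun i c => (((if (e.symm i).1 = (f.symm c).1 then
    blockRow u W (fun j => s ((e.symm i).1, j)) (e.symm i).2 (f.symm c).2 else 0 : ℤ)) : ℝ)

section
variable {d N L R m q : ℕ}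
  (e : Fin d × (Fin N ⊕ ((Option (Fin L) ⊕ Option (Fin L)) ⊕ Fin R)) ≃ Fin m)
  (f : Fin d × Option (Fin L) ≃ Fin q) (u : Fin N → Fin L → Bool) (W : ℕ)
  (s : Fin d × Fin N → Bool)

theorem hardMatrix_mulVec (β : Fin q → ℝ) (a : Fin d)
    (i : Fin N ⊕ ((Option (Fin L) ⊕ Option (Fin L)) ⊕ Fin R)) :
    (hardMatrix e f u W s *ᵥ β) (e (a, i)) =
      ∑ c, (blockRow u W (fun j => s (a, j)) i c : ℝ) * β (f (a, c)) := by
  rw [Matrix.mulVec, dotProduct, ← f.sum_comp, Fintype.sum_prod_type,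
    Finset.sum_eq_single a]
  · simp [hardMatrix]
  · intro b _ hb
    simp [hardMatrix, hb.symm]
  · simp

/-- Serves both positive and negative parts; `F 0 = 0` discards the padding rows. -/
theorem sum_comp_hardMatrix_mulVec (F : ℝ → ℝ) (hF : F 0 = 0) (β : Fin q → ℝ) :
    ∑ i, F ((hardMatrix e f u W s *ᵥ β) i) =
      ∑ a, ((∑ j, F (W * ((if s (a, j) then ∑ l, (signOf (u j l) : ℝ) * β (f (a, some l)) else 0)
          + β (f (a, none))))) +
        ∑ c, (F (β (f (a, c))) + F (-β (f (a, c))))) := by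
  rw [← e.sum_comp, Fintype.sum_prod_type]
  refine Finset.sum_congr rfl fun a _ => ?_
  rw [Fintype.sum_sum_type, Fintype.sum_sum_type, Fintype.sum_sum_type]
  simp only [hardMatrix_mulVec]
  rw [Finset.sum_add_distrib]
  congr 1
  · refine Finset.sum_congr rfl fun j _ => ?_
    rw [Fintype.sum_option]
    congr 1
    simp only [blockRow]
    split_ifs
    · push_cast
      rw [mul_add, Finset.mul_sum, add_comm]
      congr 1
      exact Finset.sum_congr rfl fun l _ => mul_assoc _ _ _
    · simp
  · simp [blockRow, hF]

/-- Bounding the size of `W` by `W` itself is wasteful but enough, since `W` will be of order `log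
n`. -/
theorem entriesInBits_hardMatrix {b : ℝ} (hW : 1 ≤ W) (hb : (W : ℝ) + 2 ≤ b) :
    EntriesInBits (hardMatrix e f u W s) b := by
  intro i c
  refine ⟨((if (e.symm i).1 = (f.symm c).1 then
    blockRow u W (fun j => s ((e.symm i).1, j)) (e.symm i).2 (f.symm c).2 else 0 : ℤ) : ℚ),
    by rw [hardMatrix, Rat.cast_intCast], ?_⟩
  refine le_trans ?_ hb
  have key : ∀ z : ℤ, |z| ≤ W → ratBits (z : ℚ) ≤ W + 2 := by
    intro z hz
    have h1 : Nat.size z.natAbs ≤ W := by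
      refine Nat.size_le.2 (lt_of_le_of_lt ?_ (Nat.lt_two_pow_self (n := W)))
      rw [Int.abs_eq_natAbs] at hz
      exact_mod_cast hz
    simp only [ratBits, Rat.num_intCast, Rat.den_intCast, Nat.size_one]
    omega
  have hW' : (1 : ℤ) ≤ W := by exact_mod_cast hW
  exact_mod_cast key _ (by
    split_ifs
    · exact abs_blockRow_le u hW' _ _ _
    · simp)

theorem sum_abs_le_sum_posPart_hardMatrix (β : Fin q → ℝ) :
    ∑ c, |β c| ≤ ∑ i, max ((hardMatrix e f u W s *ᵥ β) i) 0 := by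
  rw [sum_comp_hardMatrix_mulVec e f u W s (fun t => max t 0) (by simp), ← f.sum_comp,
    Fintype.sum_prod_type]
  refine Finset.sum_le_sum fun a _ => ?_
  refine le_trans (le_of_eq ?_) (le_add_of_nonneg_left (Finset.sum_nonneg fun j _ =>
    le_max_right _ _))
  refine Finset.sum_congr rfl fun c _ => ?_
  rcases le_total 0 (β (f (a, c))) with h | h
  · rw [abs_of_nonneg h, max_eq_left h, max_eq_right (by linarith), add_zero]
  · rw [abs_of_nonpos h, max_eq_right h, max_eq_left (by linarith), zero_add]

theorem sum_negPart_hardMatrix_le (β : Fin q → ℝ) :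
    ∑ i, max (-(hardMatrix e f u W s *ᵥ β) i) 0 ≤ ((W * N : ℕ) + 1 : ℝ) * ∑ c, |β c| := by
  rw [sum_comp_hardMatrix_mulVec e f u W s (fun t => max (-t) 0) (by simp), ← f.sum_comp,
    Fintype.sum_prod_type, Finset.mul_sum]
  refine Finset.sum_le_sum fun a _ => ?_
  rw [add_mul, one_mul]
  refine add_le_add ?_ (le_of_eq ?_)
  · have h : ∀ j : Fin N, max (-(W * ((if s (a, j) then
        ∑ l, (signOf (u j l) : ℝ) * β (f (a, some l)) else 0) + β (f (a, none))))) 0 ≤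
        W * ∑ c, |β (f (a, c))| := by
      intro j
      refine max_le ?_ (by positivity)
      rw [← mul_neg]
      refine mul_le_mul_of_nonneg_left ?_ (Nat.cast_nonneg W)
      refine (neg_le_abs _).trans ((abs_add_le _ _).trans ?_)
      rw [Fintype.sum_option, add_comm]
      gcongr
      split_ifs
      · refine (Finset.abs_sum_le_sum_abs _ _).trans (Finset.sum_le_sum fun l _ => ?_)
        rw [abs_mul, ← Int.cast_abs, abs_signOf]
        simp
      · rw [abs_zero]
        positivity
    refine (Finset.sum_le_sum fun j _ => h j).trans (le_of_eq ?_)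
    simp
    ring
  · refine Finset.sum_congr rfl fun c _ => ?_
    rcases le_total 0 (β (f (a, c))) with h | h
    · rw [abs_of_nonneg h, max_eq_right (by linarith), max_eq_left (by linarith)]; ring
    · rw [abs_of_nonpos h, max_eq_left (by linarith), max_eq_right (by linarith)]; ring

theorem complexityMeasure_hardMatrix_le :
    complexityMeasure (hardMatrix e f u W s) (fun _ => -1) ≤
      ENNReal.ofReal ((W * N : ℕ) + 1) := by
  refine iSup₂_le fun β hβ => ENNReal.div_le_of_le_mul ?_
  rw [← ENNReal.ofReal_mul (by positivity)]
  refine ENNReal.ofReal_le_ofReal ?_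
  simp only [neg_mul, one_mul, neg_neg]
  exact (sum_negPart_hardMatrix_le e f u W s β).trans
    (mul_le_mul_of_nonneg_left (sum_abs_le_sum_posPart_hardMatrix e f u W s β) (by positivity))

theorem le_complexityMeasure_hardMatrix (hd : 0 < d) :
    ENNReal.ofReal (W * N : ℕ) ≤ complexityMeasure (hardMatrix e f u W s) (fun _ => -1) := by
  let a₀ : Fin d := ⟨0, hd⟩
  -- Against `-e_none`, all `N` points of a block have value `-W`, and only the row `-e_none` is
  -- positive.
  let β : Fin q → ℝ := fun c => if f.symm c = (a₀, none) then -1 else 0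
  have hβ : ∀ a c, β (f (a, c)) = if a = a₀ ∧ c = none then -1 else 0 := by
    intro a c
    simp [β]
  have hβ0 : β ≠ 0 := by
    intro h
    have := congrFun h (f (a₀, none))
    simp [hβ] at this
  have hpos : ∑ i, max ((hardMatrix e f u W s *ᵥ β) i) 0 = 1 := by
    rw [sum_comp_hardMatrix_mulVec e f u W s (fun t => max t 0) (by simp),
      Finset.sum_eq_single a₀]
    · simp [hβ, Fintype.sum_option]
    · intro a _ ha
      simp [hβ, ha]
    · simp
  have hneg : ((W * N : ℕ) : ℝ) ≤ ∑ i, max (-(hardMatrix e f u W s *ᵥ β) i) 0 := by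
    rw [sum_comp_hardMatrix_mulVec e f u W s (fun t => max (-t) 0) (by simp),
      Finset.sum_eq_single a₀]
    · simp [hβ, Fintype.sum_option]
      linarith [mul_comm (W : ℝ) N]
    · intro a _ ha
      simp [hβ, ha]
    · simp
  refine le_trans ?_ (le_iSup₂ (f := fun (β : Fin q → ℝ) (_ : β ≠ 0) =>
    ENNReal.ofReal (∑ i, max (-1 * (hardMatrix e f u W s *ᵥ β) i) 0) /
      ENNReal.ofReal (∑ i, max (-(-1 * (hardMatrix e f u W s *ᵥ β) i)) 0)) β hβ0)
  simp only [neg_mul, one_mul, neg_neg]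
  rw [hpos, ENNReal.ofReal_one, div_one]
  exact ENNReal.ofReal_le_ofReal hneg

/-! ### Separating queries -/

/-- The query that singles out the point `p.2` of the block `p.1`. -/
def separatingQuery (M : ℝ) (p : Fin d × Fin N) : Fin q → ℝ := fun c =>
  if (f.symm c).1 = p.1 then
    M * ((f.symm c).2.elim (-((L : ℝ) - 1)) fun l => (signOf (u p.2 l) : ℝ))
  else 0

theorem sum_posPart_separatingQuery (hu : Function.Injective u) (hL : 1 ≤ L) {M : ℝ} (hM : 0 ≤ M)
    (p : Fin d × Fin N) :
    ∑ i, max ((hardMatrix e f u W s *ᵥ separatingQuery f u M p) i) 0 =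
      M * ((if s p then (W : ℝ) else 0) + (2 * L - 1)) := by
  obtain ⟨a, j⟩ := p
  have hL' : (0 : ℝ) ≤ L - 1 := by
    have : (1 : ℝ) ≤ L := by exact_mod_cast hL
    linarith
  have hnone : separatingQuery f u M (a, j) (f (a, none)) = M * -((L : ℝ) - 1) := by
    simp [separatingQuery]
  have hsome : ∀ l, separatingQuery f u M (a, j) (f (a, some l)) = M * signOf (u j l) := by
    intro l
    simp [separatingQuery]
  rw [sum_comp_hardMatrix_mulVec e f u W s (fun t => max t 0) (by simp),
    Finset.sum_eq_single a, mul_add]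
  · congr 1
    · rw [Finset.sum_eq_single j]
      · simp only [hnone, hsome]
        have h1 : ∑ l, (signOf (u j l) : ℝ) * (M * signOf (u j l)) = M * L := by
          have : ∀ l, (signOf (u j l) : ℝ) * (M * signOf (u j l)) = M := by
            intro l
            rw [mul_left_comm, ← Int.cast_mul, signOf_mul_self]
            simp
          simp [this, mul_comm]
        rw [h1]
        split_ifs
        · rw [show (W : ℝ) * (M * L + M * -((L : ℝ) - 1)) = M * W by ring]
          exact max_eq_left (by positivity)
        · rw [mul_zero, zero_add]
          refine max_eq_right ?_
          rw [show (W : ℝ) * (M * -((L : ℝ) - 1)) = -(W * (M * (L - 1))) by ring]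
          exact neg_nonpos.2 (by positivity)
      · intro i _ hij
        refine max_eq_right ?_
        refine mul_nonpos_of_nonneg_of_nonpos (Nat.cast_nonneg W) ?_
        simp only [hnone, hsome]
        split_ifs
        · have h1 : ∑ l, (signOf (u i l) : ℝ) * (M * signOf (u j l)) =
              M * ((∑ l, signOf (u i l) * signOf (u j l) : ℤ) : ℝ) := by
            push_cast
            rw [Finset.mul_sum]
            exact Finset.sum_congr rfl fun l _ => by ring
          have h2 : ((∑ l, signOf (u i l) * signOf (u j l) : ℤ) : ℝ) ≤ L - 1 := by
            exact_mod_cast sum_signOf_mul_le (fun h => hij (hu h))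
          rw [h1, ← mul_add]
          exact mul_nonpos_of_nonneg_of_nonpos hM (by linarith)
        · rw [zero_add]
          exact mul_nonpos_of_nonneg_of_nonpos hM (by linarith)
      · simp
    · have h : ∀ t : ℝ, max t 0 + max (-t) 0 = |t| := by
        intro t
        rcases le_total 0 t with h | h
        · rw [abs_of_nonneg h, max_eq_left h, max_eq_right (by linarith), add_zero]
        · rw [abs_of_nonpos h, max_eq_right h, max_eq_left (by linarith), zero_add]
      simp only [h, Fintype.sum_option, hnone, hsome, abs_mul, ← Int.cast_abs, abs_signOf,
        abs_neg, abs_of_nonneg hM, abs_of_nonneg hL']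
      simp
      ring
  · intro b _ hb
    have h0 : ∀ c, separatingQuery f u M (a, j) (f (b, c)) = 0 := by
      intro c
      simp [separatingQuery, hb]
    simp [h0]
  · simp

end

/-! ### Choice of parameters -/

theorem theorem2 :
    ∃ ε₀ c C : ℝ, 0 < ε₀ ∧ 0 < c ∧ 0 < C ∧ ∃ n₀ : ℕ, 2 ≤ n₀ ∧
      ∀ n d : ℕ, n₀ ≤ n → 1 ≤ d →
        ∃ k : ℕ, 1 ≤ k ∧ (k : ℝ) ≤ C * Real.log n ^ 4 ∧
          ∃ 𝒳 : Set (Matrix (Fin (d * n)) (Fin (d * k)) ℝ),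
            (∀ X ∈ 𝒳,
              EntriesInBits X (C * Real.log ((d * n : ℕ) : ℝ)) ∧
              ENNReal.ofReal (c * n / Real.log n ^ 2) ≤ complexityMeasure X (fun _ => -1) ∧
              complexityMeasure X (fun _ => -1) ≤ ENNReal.ofReal (C * n)) ∧
            ∀ D : DataStructure.{u} (Fin (d * n)) (Fin (d * k)),
              (∀ X ∈ 𝒳, D.ApproximatesLoss X (fun _ => -1) ε₀) →
              ∃ X ∈ 𝒳, ∃ ω : D.Ω,
                c * ((d * k : ℕ) : ℝ) * (complexityMeasure X (fun _ => -1)).toReal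
                    / Real.log n ^ 4
                  ≤ ((D.store ω X).length : ℝ) := by
  refine ⟨1 / 4, 1 / 5000, 14, by norm_num, by norm_num, by norm_num, 2 ^ 11, by norm_num, ?_⟩
  intro n d hn hd
  have hn0 : n ≠ 0 := by omega
  obtain ⟨L, hLdef⟩ : ∃ L, L = Nat.log 2 n + 1 := ⟨_, rfl⟩
  have hpow : 2 ^ (L - 1) ≤ n := by
    rw [hLdef, Nat.add_sub_cancel]
    exact Nat.pow_log_le_self 2 hn0
  have hnlt : n < 2 ^ L := by
    rw [hLdef]
    exact Nat.lt_pow_succ_log_self one_lt_two n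
  have hL12 : 12 ≤ L := by
    by_contra! h
    have := Nat.pow_le_pow_right two_pos (show L ≤ 11 by omega)
    omega
  have h120 : ∀ m, 11 ≤ m → 120 * (m + 1) ≤ 2 ^ m := by
    intro m hm
    induction m, hm using Nat.le_induction with
    | base => norm_num
    | succ m hm ih => rw [pow_succ]; omega
  have hLn : 120 * L ≤ n := by
    have := h120 (L - 1) (by omega)
    rw [Nat.sub_add_cancel (by omega)] at this
    exact this.trans hpow
  obtain ⟨W, hW⟩ : ∃ W, W = 4 * L := ⟨_, rfl⟩
  obtain ⟨N, hN⟩ : ∃ N, N = n / W := ⟨_, rfl⟩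
  have hWN : W * N ≤ n := by rw [hN]; exact Nat.mul_div_le n W
  have hWN' : n < W * N + W := by
    rw [hN]
    exact Nat.lt_mul_div_succ n (by omega)
  have hN30 : 30 ≤ N := by
    rw [hN, Nat.le_div_iff_mul_le (by omega)]
    omega
  -- Leaves room for the other rows of a block, so that the truncated subtraction in the type of `e`
  -- is exact.
  have hN48 : 48 * N ≤ n := (Nat.mul_le_mul_right N (by omega)).trans hWN
  -- the size of the logarithm
  have hnR : (1 : ℝ) ≤ n := by exact_mod_cast Nat.one_le_iff_ne_zero.2 hn0
  have hL12R : (12 : ℝ) ≤ L := by exact_mod_cast hL12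
  have hLlog : (L : ℝ) ≤ 3 * Real.log n - 2 := by
    have h1 := Real.log_le_log (by positivity)
      (show ((2 : ℝ) ^ (L - 1)) ≤ n by exact_mod_cast hpow)
    rw [Real.log_pow, Nat.cast_sub (by omega), Nat.cast_one] at h1
    have h2 : ((L : ℝ) - 1) * (1 / 2) ≤ (L - 1) * Real.log 2 := by
      apply mul_le_mul_of_nonneg_left _ (by linarith)
      linarith [Real.log_two_gt_d9]
    have h3 : ((L : ℝ) - 1) * (69 / 100) ≤ (L - 1) * Real.log 2 := by
      apply mul_le_mul_of_nonneg_left _ (by linarith)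
      linarith [Real.log_two_gt_d9]
    linarith
  set ℓ := Real.log n with hℓ
  have hℓ1 : 1 ≤ ℓ := by linarith
  have hℓ4 : ℓ ^ 2 ≤ ℓ ^ 4 := pow_le_pow_right₀ hℓ1 (by norm_num)
  have hℓ14 : ℓ ≤ ℓ ^ 4 := le_self_pow₀ hℓ1 (by norm_num)
  -- the matrices
  obtain ⟨u⟩ : Nonempty (Fin N ↪ (Fin L → Bool)) := by
    apply Function.Embedding.nonempty_of_card_le
    simp
    omega
  let e : Fin d × (Fin N ⊕ ((Option (Fin L) ⊕ Option (Fin L)) ⊕ Fin (n - N - 2 * (L + 1)))) ≃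
      Fin (d * n) := Fintype.equivFinOfCardEq (by
    simp
    left
    omega)
  let f : Fin d × Option (Fin L) ≃ Fin (d * (L + 1)) := Fintype.equivFinOfCardEq (by simp)
  have hupper := fun s => complexityMeasure_hardMatrix_le e f u W s
  refine ⟨L + 1, by omega, by push_cast; linarith, Set.range (hardMatrix e f u W), ?_, ?_⟩
  · rintro _ ⟨s, rfl⟩
    refine ⟨entriesInBits_hardMatrix e f u W s (by omega) ?_,
      le_trans ?_ (le_complexityMeasure_hardMatrix e f u W s hd), (hupper s).trans ?_⟩
    · have h1 : ℓ ≤ Real.log ((d * n : ℕ) : ℝ) := by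
        refine Real.log_le_log (by linarith) ?_
        exact_mod_cast Nat.le_mul_of_pos_left n hd
      have h2 : (W : ℝ) = 4 * L := by rw [hW]; push_cast; rfl
      linarith
    · apply ENNReal.ofReal_le_ofReal
      have h1 : (n : ℝ) ≤ 2 * (W * N : ℕ) := by exact_mod_cast (by omega : n ≤ 2 * (W * N))
      rw [div_le_iff₀ (by positivity)]
      have h2 : ((W * N : ℕ) : ℝ) * 1 ≤ (W * N : ℕ) * ℓ ^ 2 := by
        gcongr
        exact one_le_pow₀ hℓ1
      linarith
    · apply ENNReal.ofReal_le_ofReal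
      have h1 : ((W * N : ℕ) : ℝ) ≤ n := by exact_mod_cast hWN
      linarith
  · intro D hD
    have hM : (1 : ℝ) ≤ (d * n : ℕ) := by
      exact_mod_cast Nat.mul_pos hd (Nat.pos_of_ne_zero hn0)
    have hWR : (W : ℝ) = 4 * L := by rw [hW]; push_cast; rfl
    set M : ℝ := ((d * n : ℕ) : ℝ) with hMdef
    have hML : M ≤ M * L := le_mul_of_one_le_right (by linarith) (by linarith)
    -- As `M` is the number of rows, replacing the loss by the positive part costs at most `M`. The
    -- loss is at most `2 * M * L` for an off bit and at least `M * (6 * L - 1)` for an on bit; the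
    -- factors `5/4` and `3/4` leave `3 * M * L` in between.
    obtain ⟨s, ω, hω⟩ := D.exists_length_ge (hardMatrix e f u W) (fun _ => -1) (1 / 4) (3 * M * L)
      (separatingQuery f u M) (fun s => hD _ ⟨s, rfl⟩)
      (by
        intro s p hp
        have h := sum_posPart_le_logisticLoss (hardMatrix e f u W s) (separatingQuery f u M p)
        rw [sum_posPart_separatingQuery e f u W s u.injective (by omega) (by linarith), if_pos hp,
          hWR] at h
        linarith)
      (by
        intro s p hp
        have h := logisticLoss_le_sum_posPart_add_card (hardMatrix e f u W s)
          (separatingQuery f u M p)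
        rw [sum_posPart_separatingQuery e f u W s u.injective (by omega) (by linarith),
          if_neg (by simp [hp]), Fintype.card_fin, ← hMdef] at h
        linarith)
    refine ⟨_, ⟨s, rfl⟩, ω, le_trans ?_ hω⟩
    have hdR : (1 : ℝ) ≤ d := by exact_mod_cast hd
    have hNR : (30 : ℝ) ≤ N := by exact_mod_cast hN30
    have hdN : (30 : ℝ) ≤ d * N := by nlinarith
    have hμ : (complexityMeasure (hardMatrix e f u W s) fun _ => -1).toReal ≤ 8 * L * N := by
      refine (ENNReal.toReal_le_of_le_ofReal (by positivity) (hupper s)).trans ?_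
      push_cast
      rw [hWR]
      nlinarith
    rw [Fintype.card_prod, Fintype.card_fin, Fintype.card_fin, div_le_iff₀ (by positivity)]
    push_cast
    -- Since `d * N ≥ 30`, the loss of `1` in the code bound still leaves `d * N / 30`, and `144 /
    -- 5000 ≤ 1 / 30`.
    calc _ ≤ 1 / 5000 * ((d : ℝ) * (2 * L)) * (8 * L * N) := by
          gcongr
          linarith
      _ = 16 / 5000 * (d * N) * (L : ℝ) ^ 2 := by ring
      _ ≤ 16 / 5000 * (d * N) * (3 * ℓ) ^ 2 := by
          gcongr
          linarith
      _ = 144 / 5000 * (d * N) * ℓ ^ 2 := by ring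
      _ ≤ (d * N / 30) * ℓ ^ 4 := by
          gcongr
          linarith
      _ ≤ _ := by
          gcongr
          linarith
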